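/- Let $d\ge 1$ be an integer, $0<\beta\le 1$ and $L>0$. Let $(X,Y)$ be a random couple with values in $[0,1]^d\times\{-1,1\}$ and with regression function $\eta(x)=\mathbb E(Y\mid X=x)$. Suppose that $\eta$ belongs to the Hölder class $\Sigma(\beta,L,[0,1]^d)$, that is, $\eta$ is continuous and $|\eta(x)-\eta(x_1)|\le L\|x-x_1\|_\infty^{\beta}$ for all $x,x_1\in[0,1]^d$. For $m\ge 1$ let $\{R_i\}_{i\le 2^{dm}}$ be the partition of $[0,1]^d$ into the dyadic cubes with side $2^{-m}$ (half-open, closed at the upper faces of $[0,1]^d$), and let $\mathcal F_m=\{\sum_{i}\lambda_i \mathbf 1_{R_i}:\ |\lambda_i|\le 1\}$. Given $N\ge 2$, i.i.d. copies $(X_j,Y_j)$, $j\le N$, of $(X,Y)$, a number $s>0$ and a constant $K_1$, let $$\mathcal J(N)=\Big\{m\ge 1:\ 1\le \dim\mathcal F_m\le \frac{N}{\log^2N}\Big\},\qquad s_m=m\,(s+\log\log_2N),$$ where $\dim\mathcal F_m$ is the dimension of the linear span of $\mathcal F_m$, and let $\hat m$ be any minimizer over $m\in\mathcal J(N)$ of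 $$\inf_{f\in\mathcal F_m}\frac1N\sum_{j=1}^N\big(Y_j-f(X_j)\big)^2+K_1\,\frac{2^{dm}+s_m}{N}.$$ There is an absolute constant $K_0>0$, and for all $d,\beta,L$ as above there is a constant $C_1>0$ that depends only on $d,\beta,L$, such that for every $K_1\ge K_0$, every $N\ge2$ for which $\mathcal J(N)$ is non-empty, every $s>0$ and every distribution of $(X,Y)$ as above, with probability at least $1-e^{-s}$, $$2^{\hat m}\le C_1\, N^{\frac{1}{2\beta+d}}.$$ -/

import Mathlib

open MeasureTheory ProbabilityTheory

noncomputable section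

namespace ActiveLearning

/-- The unit cube `[0,1]^d`. The norm of `Fin d → ℝ` is the sup-norm. -/
def unitCube (d : ℕ) : Set (Fin d → ℝ) := Set.Icc 0 1

/-- The largest integer strictly smaller than `β` (for `β > 0`). -/
def holderOrder (β : ℝ) : ℕ := ⌈β⌉₊ - 1

/-- The value at `y` of the Taylor polynomial of degree `k` of `g` at the point `x`. -/
def taylorPoly {d : ℕ} (g : (Fin d → ℝ) → ℝ) (k : ℕ) (x y : Fin d → ℝ) : ℝ :=
  ∑ i ∈ Finset.range (k + 1),
    ((i.factorial : ℝ))⁻¹ * iteratedFDeriv ℝ i g x (fun _ => y - x)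

/-- The Hölder class `Σ(β, K, [0,1]^d)`. -/
def HolderClass (d : ℕ) (β K : ℝ) : Set ((Fin d → ℝ) → ℝ) :=
  {g | ContDiff ℝ ((holderOrder β : ℕ) : WithTop ℕ∞) g ∧
    ∀ x ∈ unitCube d, ∀ y ∈ unitCube d,
      |g y - taylorPoly g (holderOrder β) x y| ≤ K * ‖x - y‖ ^ β}

/-- The dyadic cube of side `2^{-m}` with lower corner `2^{-m} k`. The cubes are half-open, and
closed at the upper faces of the unit cube, so that they partition `[0,1]^d`. -/
def dyadicCube {d : ℕ} (m : ℕ) (k : Fin d → Fin (2 ^ m)) : Set (Fin d → ℝ) :=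
  {x ∈ unitCube d | ∀ i, ((k i : ℕ) : ℝ) / 2 ^ m ≤ x i ∧
    (x i < (((k i : ℕ) : ℝ) + 1) / 2 ^ m ∨ (k i : ℕ) + 1 = 2 ^ m)}

/-- The class `F_m` of functions `∑ λ_i 1_{R_i}` with `|λ_i| ≤ 1`, the `R_i` being the dyadic
cubes of side `2^{-m}`. -/
def pieceConst (d m : ℕ) : Set ((Fin d → ℝ) → ℝ) :=
  {f | ∃ c : (Fin d → Fin (2 ^ m)) → ℝ, (∀ k, |c k| ≤ 1) ∧
    f = fun x => ∑ k, c k * (dyadicCube m k).indicator 1 x}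

/-- The dimension of (the linear span of) `F_m`. -/
def pieceConstDim (d m : ℕ) : ℕ :=
  Module.finrank ℝ (Submodule.span ℝ (pieceConst d m))

/-- The index set `J(N)` of admissible resolution levels. -/
def resolutionLevels (d N : ℕ) : Set ℕ :=
  {m | 1 ≤ m ∧ 1 ≤ pieceConstDim d m ∧ (pieceConstDim d m : ℝ) ≤ N / (Real.log N) ^ 2}

/-- The empirical quadratic risk `P_N (Y - f(X))^2` of `f` on the sample `(x_j, y_j)`. -/
def empRisk {d N : ℕ} (x : Fin N → Fin d → ℝ) (y : Fin N → ℝ) (f : (Fin d → ℝ) → ℝ) : ℝ :=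
  (∑ j, (y j - f (x j)) ^ 2) / N

/-- The penalized criterion
`inf_{f ∈ F_m} P_N (Y - f(X))^2 + K₁ (2^{dm} + s_m) / N`, `s_m = m (s + log log₂ N)`. -/
def criterion {d N : ℕ} (K₁ s : ℝ) (x : Fin N → Fin d → ℝ) (y : Fin N → ℝ) (m : ℕ) : ℝ :=
  (⨅ f : pieceConst d m, empRisk x y f) +
    K₁ * ((2 : ℝ) ^ (d * m) + m * (s + Real.log (Real.logb 2 N))) / N

/-- `m` is an `argmin` of the penalized criterion over `J(N)`. -/
def IsSelectedResolution {d N : ℕ} (K₁ s : ℝ) (x : Fin N → Fin d → ℝ) (y : Fin N → ℝ)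
    (m : ℕ) : Prop :=
  m ∈ resolutionLevels d N ∧ IsMinOn (criterion K₁ s x y) (resolutionLevels d N) m

/-- `P` is a probability distribution on `[0,1]^d × {-1, 1}`. -/
structure IsBinaryLaw {d : ℕ} (P : Measure ((Fin d → ℝ) × ℝ)) : Prop where
  isProbabilityMeasure : IsProbabilityMeasure P
  support : ∀ᵐ z ∂P, z.1 ∈ unitCube d ∧ (z.2 = -1 ∨ z.2 = 1)

/-- `η` is (a version of) the regression function `η(x) = E(Y | X = x)` of `P`. -/
def IsRegressionFunction {d : ℕ} (P : Measure ((Fin d → ℝ) × ℝ)) (η : (Fin d → ℝ) → ℝ) : Prop :=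
  Measurable η ∧
    (fun z : (Fin d → ℝ) × ℝ => η z.1) =ᵐ[P]
      P[fun z : (Fin d → ℝ) × ℝ => z.2 |
        MeasurableSpace.comap (Prod.fst : (Fin d → ℝ) × ℝ → Fin d → ℝ) inferInstance]

/-- `(X_j, Y_j)`, `j < N`, is an i.i.d. sample from `P`. -/
structure IsIIDSample {d N : ℕ} {Ω : Type*} [MeasurableSpace Ω] (μ : Measure Ω)
    (P : Measure ((Fin d → ℝ) × ℝ)) (X : Fin N → Ω → Fin d → ℝ) (Y : Fin N → Ω → ℝ) : Prop where
  measurable_X : ∀ j, Measurable (X j)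
  measurable_Y : ∀ j, Measurable (Y j)
  law : ∀ j, μ.map (fun ω => (X j ω, Y j ω)) = P
  indep : iIndepFun (fun j ω => (X j ω, Y j ω)) μ

end ActiveLearning

end

/-!
The penalty alone rules out levels that are too fine; it suffices to bound by how much a finer
partition can lower the empirical risk. Let `m₀` be the level that balances bias and variance,
`2^{m₀} ≍ N^{1/(2β+d)}`, and let `g ∈ F_{m₀}` take on each cube the value of `η` at a corner, so
that `|η - g| ≤ L 2^{-m₀β}`. For `m ≥ m₀` and any `f ∈ F_m`, the function `f - g` is constant on
the cubes of level `m`, and completing the square on each cube shows that `N` times the gain in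
empirical risk is at most `2 ∑_j (η - g)²(X_j) + 2 Q_m`, where `Q_m` is the sum over cubes of
`(∑ (Y_j - η(X_j)))² / (number of points)` (`blockEnergy`, `le_empRisk_of_le`). The first sum is
at most `L² 2^{d m₀}` by the choice of `m₀`.

Conditionally on the design, the noise is independent and sub-Gaussian, by Hoeffding's lemma, and
writing `exp (a² / 2)` as a Gaussian average of `exp (a g)` gives `E exp (Q_m / 4) ≤ 2^{2^{dm}}`
(`lintegral_exp_blockEnergy_le`). The conditioning is made concrete by simulating the label from
`X` and an independent uniform variable (`map_coinLabel_eq`). A union bound over all levels yields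
`Q_m ≤ 4 (2 · 2^{dm} + s)` for all `m` at once with probability at least `1 - e^{-s}`
(`one_sub_exp_le_of_blockEnergy`). If `m - m₀` exceeds a constant depending on `L`, then
`2^{dm}` dominates `L² 2^{d m₀}`, and the increase of the penalty, at least
`K₁ (2^{dm} / 2 + s) / N`, is larger than the gain (`lt_of_isSelectedResolution`).

Only values of `η` at design points matter almost surely, so `η` is truncated to `[-1, 1]`; this
preserves the Hölder bound and makes the label probabilities `(1 ± η) / 2` meaningful everywhere.
-/

/-! ### Exponential moment of the block energy -/

theorem lintegral_exp_mul_gaussianReal (t : ℝ) :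
    ∫⁻ g, ENNReal.ofReal (Real.exp (t * g)) ∂gaussianReal 0 1 =
      ENNReal.ofReal (Real.exp (t ^ 2 / 2)) := by
  rw [← ofReal_integral_eq_lintegral_ofReal (integrable_exp_mul_gaussianReal t)
    (Filter.Eventually.of_forall fun _ => (Real.exp_pos _).le)]
  congr 1
  have h := congrFun (mgf_fun_id_gaussianReal (μ := 0) (v := 1)) t
  simpa [mgf] using h

theorem lintegral_exp_sq_gaussianReal_le :
    ∫⁻ g, ENNReal.ofReal (Real.exp (g ^ 2 / 4)) ∂gaussianReal 0 1 ≤ 2 := by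
  rw [gaussianReal_of_var_ne_zero 0 one_ne_zero,
    lintegral_withDensity_eq_lintegral_mul _ (measurable_gaussianPDF 0 1) (by fun_prop)]
  have hpt : ∀ x : ℝ, (gaussianPDF 0 1 * fun g => ENNReal.ofReal (Real.exp (g ^ 2 / 4))) x
      = ENNReal.ofReal ((√(2 * Real.pi))⁻¹ * Real.exp (-(1 / 4) * x ^ 2)) := by
    intro x
    rw [Pi.mul_apply, gaussianPDF, ← ENNReal.ofReal_mul (gaussianPDFReal_nonneg _ _ _)]
    congr 1
    rw [gaussianPDFReal, mul_assoc, ← Real.exp_add]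
    simp only [NNReal.coe_one, mul_one, sub_zero]
    congr 2
    ring
  have hint : Integrable fun x : ℝ => Real.exp (-(1 / 4) * x ^ 2) :=
    integrable_exp_neg_mul_sq (by norm_num)
  rw [lintegral_congr hpt, ← ofReal_integral_eq_lintegral_ofReal (hint.const_mul _)
    (Filter.Eventually.of_forall fun _ => by positivity), integral_const_mul, integral_gaussian]
  rw [show (2 : ENNReal) = ENNReal.ofReal 2 by simp]
  apply ENNReal.ofReal_le_ofReal
  rw [inv_mul_le_iff₀ (by positivity)]
  apply Real.sqrt_le_iff.2 ⟨by positivity, ?_⟩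
  rw [mul_pow, Real.sq_sqrt (by positivity)]
  linarith [Real.pi_pos]

/-- For a sample split into blocks by `κ`, the sum over the nonempty blocks of
`(∑ v_j)² / (size of the block)`: the squared norm of the projection of `v` onto the vectors that
are constant on each block. An empty block contributes `0 / 0 = 0`. -/
noncomputable def blockEnergy {N : ℕ} {K : Type*} [Fintype K] [DecidableEq K] (κ : Fin N → K)
    (v : Fin N → ℝ) : ℝ :=
  ∑ k, (∑ j with κ j = k, v j) ^ 2 / (Finset.card {j | κ j = k} : ℝ)

/-- For independent sub-Gaussian `ξ_j` the block energy has an exponential moment at most `2` to the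
number of blocks. The square in each block is linearized by a Gaussian average; this also reduces
the independence of the blocks to a sub-Gaussian bound for one linear combination of the `ξ_j`. -/
theorem lintegral_exp_blockEnergy_le {E : Type*} [MeasurableSpace E] {ν : Measure E}
    [IsProbabilityMeasure ν] {N : ℕ} {K : Type*} [Fintype K] [DecidableEq K] (κ : Fin N → K)
    {ξ : Fin N → E → ℝ} (hm : ∀ j, Measurable (ξ j)) (hind : iIndepFun ξ ν)
    (hsub : ∀ j, HasSubgaussianMGF (ξ j) 1 ν) :
    ∫⁻ u, ENNReal.ofReal (Real.exp (blockEnergy κ (fun j => ξ j u) / 4)) ∂ν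
      ≤ 2 ^ Fintype.card K := by
  set n : K → ℝ := fun k => (Finset.card {j | κ j = k} : ℝ) with hn
  set γ : Measure (K → ℝ) := Measure.pi fun _ => gaussianReal 0 1 with hγ
  set z : K → E → ℝ := fun k u => (∑ j with κ j = k, ξ j u) / √(2 * n k) with hz
  have hprod : ∀ f : K → ℝ → ENNReal, (∀ k, Measurable (f k)) →
      ∫⁻ g, ∏ k, f k (g k) ∂γ = ∏ k, ∫⁻ t, f k t ∂gaussianReal 0 1 := by
    intro f hf
    have hI : iIndepFun (fun k (g : K → ℝ) => f k (g k)) γ :=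
      iIndepFun_pi (μ := fun _ : K => gaussianReal 0 1) (X := f) fun k => (hf k).aemeasurable
    rw [lintegral_prod_eq_prod_lintegral_of_indepFun Finset.univ _ hI
      fun k => (hf k).comp (measurable_pi_apply k)]
    refine Finset.prod_congr rfl fun k _ => ?_
    rw [← (measurePreserving_eval (fun _ : K => gaussianReal 0 1) k).lintegral_comp (hf k)]
  -- Linearization: `exp (a² / 2)` is the Gaussian average of `exp (a g)`.
  have hlin : ∀ u, ENNReal.ofReal (Real.exp (blockEnergy κ (fun j => ξ j u) / 4)) =
      ∫⁻ g, ENNReal.ofReal (Real.exp (∑ k, z k u * g k)) ∂γ := by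
    intro u
    have h1 : blockEnergy κ (fun j => ξ j u) / 4 = ∑ k, z k u ^ 2 / 2 := by
      rw [blockEnergy, Finset.sum_div]
      refine Finset.sum_congr rfl fun k _ => ?_
      rw [hz]
      simp only [div_pow]
      rw [Real.sq_sqrt (by positivity)]
      ring
    rw [h1, Real.exp_sum, ENNReal.ofReal_prod_of_nonneg fun _ _ => (Real.exp_pos _).le]
    simp_rw [Real.exp_sum, ENNReal.ofReal_prod_of_nonneg fun _ _ => (Real.exp_pos _).le,
      ← lintegral_exp_mul_gaussianReal]
    rw [hprod (fun k t => ENNReal.ofReal (Real.exp (z k u * t))) fun k => by fun_prop]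
  have hzm : ∀ k, Measurable (z k) := fun k => by
    have := fun j => hm j
    fun_prop
  simp_rw [hlin]
  rw [lintegral_lintegral_swap (by fun_prop)]
  have hinner : ∀ g : K → ℝ, ∫⁻ u, ENNReal.ofReal (Real.exp (∑ k, z k u * g k)) ∂ν ≤
      ∏ k, ENNReal.ofReal (Real.exp (g k ^ 2 / 4)) := by
    intro g
    set w : Fin N → ℝ := fun j => g (κ j) / √(2 * n (κ j)) with hw
    have hsum : ∀ u, ∑ k, z k u * g k = ∑ j, w j * ξ j u := by
      intro u
      rw [← Finset.sum_fiberwise (s := Finset.univ) (g := κ)]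
      refine Finset.sum_congr rfl fun k _ => ?_
      rw [hz]
      simp only
      rw [div_mul_eq_mul_div, Finset.sum_mul, Finset.sum_div]
      refine Finset.sum_congr rfl fun j hj => ?_
      rw [hw]
      simp only [(Finset.mem_filter.1 hj).2]
      ring
    have hsq : ∑ j, w j ^ 2 ≤ ∑ k, g k ^ 2 / 2 := by
      rw [← Finset.sum_fiberwise (s := Finset.univ) (g := κ)]
      refine Finset.sum_le_sum fun k _ => ?_
      have : ∑ j with κ j = k, w j ^ 2 = ∑ j with κ j = k, g k ^ 2 / (2 * n k) := by
        refine Finset.sum_congr rfl fun j hj => ?_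
        rw [hw]
        simp only [(Finset.mem_filter.1 hj).2, div_pow]
        rw [Real.sq_sqrt (by positivity)]
      rw [this, Finset.sum_const, nsmul_eq_mul]
      rcases (Nat.cast_nonneg (Finset.card {j | κ j = k}) : (0 : ℝ) ≤ _).eq_or_lt with h | h
      · rw [← h, zero_mul]; positivity
      · rw [hn]
        simp only
        field_simp
        rfl
    have hI : iIndepFun (fun j u => w j * ξ j u) ν :=
      hind.comp (fun j t => w j * t) fun j => by fun_prop
    have hS := HasSubgaussianMGF.sum_of_iIndepFun hI (s := Finset.univ)
      fun j _ => (hsub j).const_mul (w j)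
    have h1 := hS.mgf_le 1
    have h2 := hS.integrable_exp_mul 1
    simp only [one_mul] at h2
    simp_rw [hsum]
    rw [← ofReal_integral_eq_lintegral_ofReal h2
      (Filter.Eventually.of_forall fun _ => (Real.exp_pos _).le),
      ← ENNReal.ofReal_prod_of_nonneg fun _ _ => (Real.exp_pos _).le, ← Real.exp_sum]
    apply ENNReal.ofReal_le_ofReal
    simp only [mgf, one_mul] at h1
    refine h1.trans (Real.exp_le_exp.2 ?_)
    rw [one_pow, mul_one, NNReal.coe_sum]
    calc _ = (∑ j, w j ^ 2) / 2 := by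
          congr 1
          exact Finset.sum_congr rfl fun j _ => mul_one _
      _ ≤ (∑ k, g k ^ 2 / 2) / 2 := by gcongr
      _ = ∑ k, g k ^ 2 / 4 := by
        rw [Finset.sum_div]
        exact Finset.sum_congr rfl fun k _ => by ring
  refine (lintegral_mono hinner).trans ?_
  rw [hprod (fun _ t => ENNReal.ofReal (Real.exp (t ^ 2 / 4))) fun k => by fun_prop]
  simp only [Finset.prod_const, Finset.card_univ]
  gcongr
  exact lintegral_exp_sq_gaussianReal_le

/-! ### Simulation of the sample by uniform variables -/

/-- The uniform distribution on `(0, 1]`. -/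
noncomputable def uniformUnit : Measure ℝ := volume.restrict (Set.Ioc 0 1)

instance : IsProbabilityMeasure uniformUnit := ⟨by simp [uniformUnit]⟩

/-- The `±1` label with mean `p` read off a uniform variable `u`: it is `1` for `u ≤ (1 + p) / 2`
and `-1` otherwise. -/
noncomputable def coinLabel (p u : ℝ) : ℝ := if u ≤ (1 + p) / 2 then 1 else -1

theorem coinLabel_eq_or (p u : ℝ) : coinLabel p u = -1 ∨ coinLabel p u = 1 := by
  unfold coinLabel
  split_ifs <;> simp

theorem measurable_coinLabel : Measurable fun z : ℝ × ℝ => coinLabel z.1 z.2 :=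
  Measurable.ite (measurableSet_le (by fun_prop) (by fun_prop)) measurable_const measurable_const

theorem uniformUnit_coinLabel_eq {p ε : ℝ} (hp : |p| ≤ 1) (hε : ε = -1 ∨ ε = 1) :
    uniformUnit {u | coinLabel p u = ε} = ENNReal.ofReal ((1 + ε * p) / 2) := by
  obtain ⟨h1, h2⟩ := abs_le.1 hp
  rcases hε with rfl | rfl
  · have hs : {u | coinLabel p u = -1} = Set.Ioi ((1 + p) / 2) := by
      ext u
      simp only [coinLabel, Set.mem_ofPred_eq, Set.mem_Ioi]
      split_ifs with h
      · norm_num; linarith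
      · simpa using h
    rw [hs, uniformUnit, Measure.restrict_apply measurableSet_Ioi, Set.inter_comm,
      Set.Ioc_inter_Ioi, sup_eq_right.2 (by linarith), Real.volume_Ioc]
    congr 1
    ring
  · have hs : {u | coinLabel p u = 1} = Set.Iic ((1 + p) / 2) := by
      ext u
      simp only [coinLabel, Set.mem_ofPred_eq, Set.mem_Iic]
      split_ifs with h
      · simpa using h
      · norm_num; linarith
    rw [hs, uniformUnit, Measure.restrict_apply measurableSet_Iic, Set.inter_comm,
      Set.Ioc_inter_Iic, inf_eq_right.2 (by linarith), Real.volume_Ioc]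
    congr 1
    ring

theorem integral_coinLabel {p : ℝ} (hp : |p| ≤ 1) : ∫ u, coinLabel p u ∂uniformUnit = p := by
  have hm : Measurable (coinLabel p) := measurable_coinLabel.comp measurable_prodMk_left
  have hS : MeasurableSet {u | coinLabel p u = 1} := hm (measurableSet_singleton 1)
  have hpt : ∀ u, coinLabel p u =
      2 * {u | coinLabel p u = 1}.indicator (fun _ => (1 : ℝ)) u - 1 := by
    intro u
    rcases coinLabel_eq_or p u with h | h <;> simp [Set.indicator, h] <;> norm_num
  have hr : uniformUnit.real {u | coinLabel p u = 1} = (1 + p) / 2 := by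
    rw [measureReal_def, uniformUnit_coinLabel_eq hp (Or.inr rfl), one_mul,
      ENNReal.toReal_ofReal (by linarith [(abs_le.1 hp).1])]
  rw [integral_congr_ae (Filter.Eventually.of_forall hpt), integral_sub
    (((integrable_const 1).indicator hS).const_mul 2) (integrable_const _), integral_const_mul,
    integral_indicator_const _ hS, hr]
  simp
  ring

theorem hasSubgaussianMGF_coinLabel {p : ℝ} (hp : |p| ≤ 1) :
    HasSubgaussianMGF (fun u => coinLabel p u - p) 1 uniformUnit := by
  have hm : Measurable (coinLabel p) := measurable_coinLabel.comp measurable_prodMk_left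
  have h := hasSubgaussianMGF_of_mem_Icc (μ := uniformUnit) (X := coinLabel p) (a := -1) (b := 1)
    hm.aemeasurable (Filter.Eventually.of_forall fun u => by
      rcases coinLabel_eq_or p u with h | h <;> rw [h] <;> norm_num)
  rw [integral_coinLabel hp] at h
  convert h using 1
  ext
  norm_num

/-- A law on `E × ℝ` whose second coordinate is `±1` is determined by its values on the sets
`B × {-1}` and `B × {1}`. -/
theorem measure_ext_of_sign {E : Type*} [MeasurableSpace E] {P Q : Measure (E × ℝ)}
    (hP : ∀ᵐ z ∂P, z.2 = -1 ∨ z.2 = 1) (hQ : ∀ᵐ z ∂Q, z.2 = -1 ∨ z.2 = 1)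
    (h : ∀ (B : Set E), MeasurableSet B → ∀ ε : ℝ, ε = -1 ∨ ε = 1 →
      P (B ×ˢ {ε}) = Q (B ×ˢ {ε})) : P = Q := by
  ext A hA
  have hdec : ∀ ρ : Measure (E × ℝ), (∀ᵐ z ∂ρ, z.2 = -1 ∨ z.2 = 1) →
      ρ A = ρ (((fun x => (x, (-1 : ℝ))) ⁻¹' A) ×ˢ {-1}) +
        ρ (((fun x => (x, (1 : ℝ))) ⁻¹' A) ×ˢ {1}) := by
    intro ρ hρ
    rw [← measure_union]
    · apply measure_congr
      filter_upwards [hρ] with z hz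
      apply propext
      rcases z with ⟨x, y⟩
      simp only at hz
      change (x, y) ∈ A ↔ (x, y) ∈
        (((fun x => (x, (-1 : ℝ))) ⁻¹' A) ×ˢ {-1} ∪
          ((fun x => (x, (1 : ℝ))) ⁻¹' A) ×ˢ {1} : Set (E × ℝ))
      rcases hz with rfl | rfl
      · simp
        norm_num
      · simp
        norm_num
    · rw [Set.disjoint_left]
      rintro ⟨x, y⟩ h1 h2
      simp at h1 h2
      linarith [h1.2, h2.2]
    · exact (measurable_prodMk_right hA).prod (measurableSet_singleton _)
  rw [hdec P hP, hdec Q hQ, h _ (measurable_prodMk_right hA) _ (Or.inl rfl),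
    h _ (measurable_prodMk_right hA) _ (Or.inr rfl)]

/-- On `y = ±1` the indicator of `y = ε` is `(1 + ε y) / 2`, and `y` may be replaced by `η(x)` when
integrating over a set of the form `x ∈ B`. -/
theorem measureReal_prod_sign {d : ℕ} {P : Measure ((Fin d → ℝ) × ℝ)}
    (hP : ActiveLearning.IsBinaryLaw P) {η : (Fin d → ℝ) → ℝ}
    (hη : ActiveLearning.IsRegressionFunction P η) {B : Set (Fin d → ℝ)} (hB : MeasurableSet B)
    {ε : ℝ} (hε : ε = -1 ∨ ε = 1) :
    P.real (B ×ˢ {ε}) = ∫ z in Prod.fst ⁻¹' B, (1 + ε * η z.1) / 2 ∂P := by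
  have := hP.isProbabilityMeasure
  have hy : Integrable (fun z : (Fin d → ℝ) × ℝ => z.2) P := by
    refine Integrable.of_bound measurable_snd.aestronglyMeasurable 1 ?_
    filter_upwards [hP.support] with z hz
    rcases hz.2 with h | h <;> rw [h] <;> norm_num
  have hηi : Integrable (fun z : (Fin d → ℝ) × ℝ => η z.1) P :=
    (integrable_congr hη.2).2 integrable_condExp
  have hS : MeasurableSet (Prod.fst ⁻¹' B : Set ((Fin d → ℝ) × ℝ)) := measurable_fst hB
  have hcond : ∫ z in Prod.fst ⁻¹' B, η z.1 ∂P = ∫ z in Prod.fst ⁻¹' B, z.2 ∂P := by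
    rw [← setIntegral_condExp (measurable_fst.comap_le) hy ⟨B, hB, rfl⟩]
    exact setIntegral_congr_ae hS (hη.2.mono fun z hz _ => hz)
  have hind : ∀ f : (Fin d → ℝ) × ℝ → ℝ, Integrable f P →
      ∫ z in Prod.fst ⁻¹' B, (1 + ε * f z) / 2 ∂P =
        (P.real (Prod.fst ⁻¹' B) + ε * ∫ z in Prod.fst ⁻¹' B, f z ∂P) / 2 := by
    intro f hf
    rw [integral_div, integral_add (integrable_const _) (hf.integrableOn.const_mul _),
      integral_const_mul]
    simp
  rw [hind _ hηi, hcond, ← hind _ hy]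
  have hset : MeasurableSet (Set.univ ×ˢ {ε} : Set ((Fin d → ℝ) × ℝ)) :=
    MeasurableSet.univ.prod (measurableSet_singleton _)
  have h1 : ∀ᵐ z ∂P.restrict (Prod.fst ⁻¹' B),
      (1 + ε * z.2) / 2 = (Set.univ ×ˢ {ε} : Set ((Fin d → ℝ) × ℝ)).indicator (fun _ => 1) z := by
    filter_upwards [ae_restrict_of_ae hP.support] with z hz
    rcases hz.2 with h | h <;> rcases hε with rfl | rfl <;> simp [Set.indicator, h] <;> norm_num
  rw [integral_congr_ae h1, integral_indicator_const _ hset, measureReal_restrict_apply hset]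
  simp only [smul_eq_mul, mul_one]
  congr 1
  ext z
  simp [and_comm]

/-- Simulation of the law of `(X, Y)`: draw `X` from its marginal, an independent uniform variable
`u`, and let the label be `1` for `u ≤ (1 + η(X)) / 2` and `-1` otherwise. -/
theorem map_coinLabel_eq {d : ℕ} {P : Measure ((Fin d → ℝ) × ℝ)}
    (hP : ActiveLearning.IsBinaryLaw P) {η : (Fin d → ℝ) → ℝ}
    (hη : ActiveLearning.IsRegressionFunction P η) (hη1 : ∀ x, |η x| ≤ 1) :
    ((P.map Prod.fst).prod uniformUnit).map (fun z => (z.1, coinLabel (η z.1) z.2)) = P := by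
  have := hP.isProbabilityMeasure
  have := Measure.isProbabilityMeasure_map (μ := P) (f := Prod.fst) measurable_fst.aemeasurable
  have hm : Measurable fun z : (Fin d → ℝ) × ℝ => coinLabel (η z.1) z.2 :=
    measurable_coinLabel.comp ((hη.1.comp measurable_fst).prodMk measurable_snd)
  have hΦ : Measurable fun z : (Fin d → ℝ) × ℝ => (z.1, coinLabel (η z.1) z.2) :=
    measurable_fst.prodMk hm
  symm
  refine measure_ext_of_sign (hP.support.mono fun z hz => hz.2) ?_ ?_
  · refine (ae_map_iff hΦ.aemeasurable
      ((measurableSet_eq_fun measurable_snd measurable_const).union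
        (measurableSet_eq_fun measurable_snd measurable_const))).2 ?_
    exact Filter.Eventually.of_forall fun z => coinLabel_eq_or _ _
  · intro B hB ε hε
    have hpos : ∀ x, 0 ≤ (1 + ε * η x) / 2 := by
      intro x
      obtain ⟨h1, h2⟩ := abs_le.1 (hη1 x)
      rcases hε with rfl | rfl <;> linarith
    have hBε : MeasurableSet (B ×ˢ {ε} : Set ((Fin d → ℝ) × ℝ)) :=
      hB.prod (measurableSet_singleton _)
    rw [← ofReal_measureReal, measureReal_prod_sign hP hη hB hε,
      ofReal_integral_eq_lintegral_ofReal, Measure.map_apply hΦ hBε,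
      Measure.prod_apply (hΦ hBε)]
    · have hx : ∀ x, uniformUnit (Prod.mk x ⁻¹'
          ((fun z : (Fin d → ℝ) × ℝ => (z.1, coinLabel (η z.1) z.2)) ⁻¹' (B ×ˢ {ε}))) =
          B.indicator (fun x => ENNReal.ofReal ((1 + ε * η x) / 2)) x := by
        intro x
        by_cases hxB : x ∈ B
        · rw [Set.indicator_of_mem hxB, ← uniformUnit_coinLabel_eq (hη1 x) hε]
          congr 1
          ext u
          simp [hxB]
        · rw [Set.indicator_of_notMem hxB]
          convert measure_empty (μ := uniformUnit)
          ext u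
          simp [hxB]
      simp_rw [hx]
      have hmη := hη.1
      rw [lintegral_indicator hB, setLIntegral_map hB (by fun_prop) measurable_fst]
    · refine Integrable.integrableOn ?_
      have hmη := hη.1
      refine Integrable.of_bound (Measurable.aestronglyMeasurable (by fun_prop)) 1 ?_
      refine Filter.Eventually.of_forall fun z => ?_
      rw [Real.norm_of_nonneg (hpos _)]
      obtain ⟨h1, h2⟩ := abs_le.1 (hη1 z.1)
      rcases hε with rfl | rfl <;> linarith
    · exact Filter.Eventually.of_forall fun z => hpos _

/-- Under the law of the sample, the design points may be frozen and the labels integrated out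
first, as functions of independent uniform variables. -/
theorem lintegral_pi_eq_lintegral_coinLabel {d N : ℕ} {P : Measure ((Fin d → ℝ) × ℝ)}
    (hP : ActiveLearning.IsBinaryLaw P) {η : (Fin d → ℝ) → ℝ}
    (hη : ActiveLearning.IsRegressionFunction P η) (hη1 : ∀ x, |η x| ≤ 1)
    {F : (Fin N → (Fin d → ℝ) × ℝ) → ENNReal} (hF : Measurable F) :
    ∫⁻ z, F z ∂Measure.pi (fun _ => P) =
      ∫⁻ x, ∫⁻ u, F (fun j => (x j, coinLabel (η (x j)) (u j)))
        ∂Measure.pi (fun _ => uniformUnit) ∂Measure.pi (fun _ => P.map Prod.fst) := by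
  have := hP.isProbabilityMeasure
  have := Measure.isProbabilityMeasure_map (μ := P) (f := Prod.fst) measurable_fst.aemeasurable
  have hm : Measurable fun z : (Fin d → ℝ) × ℝ => coinLabel (η z.1) z.2 :=
    measurable_coinLabel.comp ((hη.1.comp measurable_fst).prodMk measurable_snd)
  have hΦ : Measurable fun z : (Fin d → ℝ) × ℝ => (z.1, coinLabel (η z.1) z.2) :=
    measurable_fst.prodMk hm
  have hlaw := map_coinLabel_eq hP hη hη1
  have hprob : IsProbabilityMeasure (((P.map Prod.fst).prod uniformUnit).map
      fun z => (z.1, coinLabel (η z.1) z.2)) := by rw [hlaw]; infer_instance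
  have hpi : Measure.pi (fun _ : Fin N => P) =
      (Measure.pi fun _ : Fin N => (P.map Prod.fst).prod uniformUnit).map
        fun z j => ((z j).1, coinLabel (η (z j).1) (z j).2) := by
    have h := Measure.pi_map_pi (μ := fun _ : Fin N => (P.map Prod.fst).prod uniformUnit)
      (f := fun _ z => (z.1, coinLabel (η z.1) z.2)) fun _ => hΦ.aemeasurable
    rw [h, hlaw]
  have hΨ : Measurable fun (z : Fin N → (Fin d → ℝ) × ℝ) j =>
      ((z j).1, coinLabel (η (z j).1) (z j).2) :=
    measurable_pi_lambda _ fun j => hΦ.comp (measurable_pi_apply j)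
  have hmp := (measurePreserving_arrowProdEquivProdArrow (Fin d → ℝ) ℝ (Fin N)
    (fun _ => P.map Prod.fst) (fun _ => uniformUnit)).symm
  have hcomp := hmp.lintegral_comp (hF.comp hΨ)
  rw [hpi, lintegral_map hF hΨ]
  refine hcomp.symm.trans ?_
  exact lintegral_prod _ ((hF.comp hΨ).comp hmp.measurable).aemeasurable

/-! ### Deviation of the noise energy -/

theorem measurable_blockEnergy {d N : ℕ} {K : Type*} [Fintype K] [DecidableEq K]
    {κ : (Fin d → ℝ) → K} (hκ : ∀ k, MeasurableSet (κ ⁻¹' {k})) {η : (Fin d → ℝ) → ℝ}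
    (hη : Measurable η) :
    Measurable fun z : Fin N → (Fin d → ℝ) × ℝ =>
      blockEnergy (fun j => κ (z j).1) (fun j => (z j).2 - η (z j).1) := by
  have hset : ∀ (k : K) (j : Fin N),
      MeasurableSet {z : Fin N → (Fin d → ℝ) × ℝ | κ (z j).1 = k} := fun k j =>
    (measurable_fst.comp (measurable_pi_apply j)) (hκ k)
  simp only [blockEnergy, Finset.sum_filter, Finset.card_filter, Nat.cast_sum]
  refine Finset.measurable_sum _ fun k _ => Measurable.div (Measurable.pow_const ?_ 2) ?_
  · refine Finset.measurable_sum _ fun j _ => Measurable.ite (hset k j) (by fun_prop)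
      measurable_const
  · refine Finset.measurable_sum _ fun j _ => ?_
    simp only [Nat.cast_ite]
    exact Measurable.ite (hset k j) measurable_const measurable_const

theorem lintegral_pi_exp_blockEnergy_le {d N : ℕ} {P : Measure ((Fin d → ℝ) × ℝ)}
    (hP : ActiveLearning.IsBinaryLaw P) {η : (Fin d → ℝ) → ℝ}
    (hη : ActiveLearning.IsRegressionFunction P η) (hη1 : ∀ x, |η x| ≤ 1)
    {K : Type*} [Fintype K] [DecidableEq K]
    {κ : (Fin d → ℝ) → K} (hκ : ∀ k, MeasurableSet (κ ⁻¹' {k})) :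
    ∫⁻ z, ENNReal.ofReal (Real.exp (blockEnergy (fun j => κ (z j).1)
      (fun j => (z j).2 - η (z j).1) / 4)) ∂Measure.pi (fun _ : Fin N => P)
      ≤ 2 ^ Fintype.card K := by
  have := hP.isProbabilityMeasure
  have := Measure.isProbabilityMeasure_map (μ := P) (f := Prod.fst) measurable_fst.aemeasurable
  have hm := measurable_blockEnergy (N := N) hκ hη.1
  rw [lintegral_pi_eq_lintegral_coinLabel hP hη hη1 (by fun_prop)]
  -- For fixed design points `x`, the centred labels are independent and sub-Gaussian.
  refine (lintegral_mono fun x => ?_).trans_eq (by simp : ∫⁻ _, 2 ^ Fintype.card K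
    ∂Measure.pi (fun _ : Fin N => P.map Prod.fst) = _)
  have hc : ∀ j, Measurable fun u => coinLabel (η (x j)) u - η (x j) := fun j =>
    (measurable_coinLabel.comp measurable_prodMk_left).sub_const _
  refine lintegral_exp_blockEnergy_le (ν := Measure.pi fun _ : Fin N => uniformUnit)
    (fun j => κ (x j)) (ξ := fun j u => coinLabel (η (x j)) (u j) - η (x j))
    (fun j => (hc j).comp (measurable_pi_apply j)) ?_ fun j => ?_
  · exact iIndepFun_pi (μ := fun _ : Fin N => uniformUnit)
      (X := fun j u => coinLabel (η (x j)) u - η (x j)) fun j => (hc j).aemeasurable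
  · refine HasSubgaussianMGF.of_map (Y := fun u : Fin N → ℝ => u j)
      (X := fun u => coinLabel (η (x j)) u - η (x j)) (measurable_pi_apply j).aemeasurable ?_
    rw [(measurePreserving_eval (fun _ : Fin N => uniformUnit) j).map_eq]
    exact hasSubgaussianMGF_coinLabel (hη1 _)

/-- Deviation inequality for the noise energy on a fixed partition of the design space, by the
exponential Markov inequality. -/
theorem measure_blockEnergy_ge_le {d N : ℕ} {Ω : Type*} [MeasurableSpace Ω] {μ : Measure Ω}
    [IsProbabilityMeasure μ] {P : Measure ((Fin d → ℝ) × ℝ)}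
    (hP : ActiveLearning.IsBinaryLaw P) {η : (Fin d → ℝ) → ℝ}
    (hη : ActiveLearning.IsRegressionFunction P η) (hη1 : ∀ x, |η x| ≤ 1)
    {X : Fin N → Ω → Fin d → ℝ} {Y : Fin N → Ω → ℝ}
    (hXY : ActiveLearning.IsIIDSample μ P X Y) {K : Type*} [Fintype K] [DecidableEq K]
    {κ : (Fin d → ℝ) → K} (hκ : ∀ k, MeasurableSet (κ ⁻¹' {k})) (t : ℝ) :
    μ {ω | 4 * (Fintype.card K * Real.log 2 + t) ≤
        blockEnergy (fun j => κ (X j ω)) (fun j => Y j ω - η (X j ω))}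
      ≤ ENNReal.ofReal (Real.exp (-t)) := by
  have := hP.isProbabilityMeasure
  have hmeas : ∀ j, Measurable fun ω => (X j ω, Y j ω) := fun j =>
    (hXY.measurable_X j).prodMk (hXY.measurable_Y j)
  have hlaw : μ.map (fun ω j => (X j ω, Y j ω)) = Measure.pi fun _ => P := by
    rw [(iIndepFun_iff_map_fun_eq_pi_map fun j => (hmeas j).aemeasurable).1 hXY.indep]
    simp_rw [hXY.law]
  have hm := measurable_blockEnergy (N := N) hκ hη.1
  have hS : MeasurableSet {z : Fin N → (Fin d → ℝ) × ℝ |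
      4 * (Fintype.card K * Real.log 2 + t) ≤
        blockEnergy (fun j => κ (z j).1) (fun j => (z j).2 - η (z j).1)} :=
    measurableSet_le measurable_const hm
  have hle := (mul_meas_ge_le_lintegral (μ := Measure.pi fun _ : Fin N => P)
    (f := fun z => ENNReal.ofReal (Real.exp (blockEnergy (fun j => κ (z j).1)
      (fun j => (z j).2 - η (z j).1) / 4))) (by fun_prop)
    (ENNReal.ofReal (2 ^ Fintype.card K * Real.exp t))).trans
      (lintegral_pi_exp_blockEnergy_le hP hη hη1 hκ)
  have hsub : {z : Fin N → (Fin d → ℝ) × ℝ | 4 * (Fintype.card K * Real.log 2 + t) ≤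
        blockEnergy (fun j => κ (z j).1) (fun j => (z j).2 - η (z j).1)} ⊆
      {z | ENNReal.ofReal (2 ^ Fintype.card K * Real.exp t) ≤
        ENNReal.ofReal (Real.exp (blockEnergy (fun j => κ (z j).1)
          (fun j => (z j).2 - η (z j).1) / 4))} := by
    intro z hz
    apply ENNReal.ofReal_le_ofReal
    have h2 : (2 : ℝ) ^ Fintype.card K = Real.exp (Fintype.card K * Real.log 2) := by
      rw [mul_comm, Real.exp_mul, Real.exp_log (by norm_num), Real.rpow_natCast]
    rw [h2, ← Real.exp_add]
    apply Real.exp_le_exp.2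
    have : 4 * (Fintype.card K * Real.log 2 + t) ≤ _ := hz
    linarith
  have heq : μ {ω | 4 * (Fintype.card K * Real.log 2 + t) ≤
        blockEnergy (fun j => κ (X j ω)) (fun j => Y j ω - η (X j ω))} =
      Measure.pi (fun _ : Fin N => P) {z | 4 * (Fintype.card K * Real.log 2 + t) ≤
        blockEnergy (fun j => κ (z j).1) (fun j => (z j).2 - η (z j).1)} := by
    rw [← hlaw, Measure.map_apply (measurable_pi_lambda _ hmeas) hS]
    rfl
  have h2 : (2 : ENNReal) ^ Fintype.card K = ENNReal.ofReal (2 ^ Fintype.card K) := by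
    rw [ENNReal.ofReal_pow (by norm_num)]
    simp
  rw [heq]
  refine (measure_mono hsub).trans ?_
  rw [ENNReal.ofReal_mul (by positivity), ← h2, mul_assoc] at hle
  have h3 := (ENNReal.mul_le_mul_iff_right (a := 2 ^ Fintype.card K) (by simp) (by simp)).1
    (hle.trans_eq (mul_one _).symm)
  rw [Real.exp_neg, ENNReal.ofReal_inv_of_pos (Real.exp_pos t)]
  rw [ENNReal.le_inv_iff_mul_le, mul_comm, ENNReal.ofReal_mul (by positivity), ← h2]
  exact h3

/-! ### Dyadic cubes and piecewise constant functions -/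

/-- The index of the dyadic cube of side `2^{-m}` containing `x`, for `x` in the unit cube. The
truncation puts the upper faces of the unit cube into the last cubes. -/
noncomputable def cellIndex {d : ℕ} (m : ℕ) (x : Fin d → ℝ) : Fin d → Fin (2 ^ m) := fun i =>
  ⟨min ⌊x i * 2 ^ m⌋₊ (2 ^ m - 1),
    (min_le_right _ _).trans_lt (Nat.sub_lt (by positivity) one_pos)⟩

theorem mem_dyadicCube_iff {d m : ℕ} {x : Fin d → ℝ} (hx : x ∈ ActiveLearning.unitCube d)
    (k : Fin d → Fin (2 ^ m)) : x ∈ ActiveLearning.dyadicCube m k ↔ cellIndex m x = k := by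
  have h2 : (0 : ℝ) < 2 ^ m := by positivity
  rw [ActiveLearning.dyadicCube, Set.mem_sep_iff, and_iff_right hx, funext_iff]
  refine forall_congr' fun i => ?_
  have hx0 : 0 ≤ x i * 2 ^ m := mul_nonneg (hx.1 i) h2.le
  have hk := (k i).2
  rw [div_le_iff₀ h2, lt_div_iff₀ h2, Fin.ext_iff, cellIndex]
  simp only
  rw [← Nat.le_floor_iff hx0]
  have hlt : x i * 2 ^ m < (k i : ℕ) + 1 ↔ ⌊x i * 2 ^ m⌋₊ < (k i : ℕ) + 1 := by
    rw [Nat.floor_lt hx0]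
    push_cast
    rfl
  rw [hlt]
  omega

theorem measurableSet_cellIndex_preimage {d : ℕ} (m : ℕ) (k : Fin d → Fin (2 ^ m)) :
    MeasurableSet (cellIndex m ⁻¹' {k}) := by
  refine (measurable_pi_lambda (cellIndex (d := d) m) fun i => ?_) (measurableSet_singleton k)
  refine measurable_from_nat (f := fun q : ℕ => (⟨min q (2 ^ m - 1),
    (min_le_right _ _).trans_lt (Nat.sub_lt (by positivity) one_pos)⟩ : Fin (2 ^ m))) |>.comp
    (Nat.measurable_floor.comp ((measurable_pi_apply i).mul_const _))

/-- The index of the cube of side `2^{-m₀}` containing the cube of side `2^{-m}` of index `k`. -/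
def coarsen {d m₀ m : ℕ} (h : m₀ ≤ m) (k : Fin d → Fin (2 ^ m)) : Fin d → Fin (2 ^ m₀) := fun i =>
  ⟨(k i : ℕ) / 2 ^ (m - m₀), Nat.div_lt_of_lt_mul (by
    rw [← pow_add, Nat.sub_add_cancel h]
    exact (k i).2)⟩

/-- The dyadic partitions are nested. -/
theorem coarsen_cellIndex {d m₀ m : ℕ} (h : m₀ ≤ m) (x : Fin d → ℝ) :
    coarsen h (cellIndex m x) = cellIndex m₀ x := by
  obtain ⟨a, rfl⟩ := Nat.exists_eq_add_of_le h
  ext i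
  simp only [coarsen, cellIndex, Nat.add_sub_cancel_left]
  have hfl : ⌊x i * 2 ^ (m₀ + a)⌋₊ / 2 ^ a = ⌊x i * 2 ^ m₀⌋₊ := by
    have := Nat.floor_div_natCast (x i * 2 ^ (m₀ + a)) (2 ^ a)
    rw [← this]
    congr 1
    push_cast
    rw [pow_add]
    field_simp
  have htop : (2 ^ (m₀ + a) - 1) / 2 ^ a = 2 ^ m₀ - 1 := by
    have h1 : 0 < 2 ^ m₀ := by positivity
    have h2 : 0 < 2 ^ a := by positivity
    apply Nat.div_eq_of_lt_le
    · rw [pow_add, Nat.sub_mul]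
      omega
    · rw [pow_add, Nat.sub_add_cancel h1]
      have : 0 < 2 ^ m₀ * 2 ^ a := by positivity
      omega
  have hmono : Monotone fun q : ℕ => q / 2 ^ a := fun _ _ hq => Nat.div_le_div_right hq
  have := hmono.map_min (a := ⌊x i * 2 ^ (m₀ + a)⌋₊) (b := 2 ^ (m₀ + a) - 1)
  rw [this, hfl, htop]

open Classical in
/-- The dyadic cubes partition the unit cube; outside it, functions of `F_m` vanish. -/
theorem sum_mul_indicator_dyadicCube {d m : ℕ} (c : (Fin d → Fin (2 ^ m)) → ℝ) (x : Fin d → ℝ) :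
    ∑ k, c k * (ActiveLearning.dyadicCube m k).indicator 1 x =
      if x ∈ ActiveLearning.unitCube d then c (cellIndex m x) else 0 := by
  split_ifs with hx
  · rw [Finset.sum_eq_single (cellIndex m x)]
    · rw [Set.indicator_of_mem ((mem_dyadicCube_iff hx _).2 rfl)]
      simp
    · intro k _ hk
      rw [Set.indicator_of_notMem fun h => hk ((mem_dyadicCube_iff hx _).1 h).symm, mul_zero]
    · simp
  · refine Finset.sum_eq_zero fun k _ => ?_
    rw [Set.indicator_of_notMem fun h => hx h.1, mul_zero]

theorem pieceConst_subset {d m₀ m : ℕ} (h : m₀ ≤ m) :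
    ActiveLearning.pieceConst d m₀ ⊆ ActiveLearning.pieceConst d m := by
  rintro f ⟨c, hc, rfl⟩
  refine ⟨fun k => c (coarsen h k), fun k => hc _, ?_⟩
  ext x
  classical
  rw [sum_mul_indicator_dyadicCube, sum_mul_indicator_dyadicCube, coarsen_cellIndex]

theorem zero_mem_pieceConst (d m : ℕ) : (0 : (Fin d → ℝ) → ℝ) ∈ ActiveLearning.pieceConst d m :=
  ⟨0, by simp, by ext; simp⟩

theorem finiteDimensional_span_pieceConst (d m : ℕ) :
    FiniteDimensional ℝ (Submodule.span ℝ (ActiveLearning.pieceConst d m)) := by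
  have hle : Submodule.span ℝ (ActiveLearning.pieceConst d m) ≤ Submodule.span ℝ (Set.range
      fun k => (ActiveLearning.dyadicCube (d := d) m k).indicator (1 : (Fin d → ℝ) → ℝ)) := by
    refine Submodule.span_le.2 ?_
    rintro f ⟨c, -, rfl⟩
    have : (fun x => ∑ k, c k * (ActiveLearning.dyadicCube m k).indicator 1 x) =
        ∑ k, c k • (ActiveLearning.dyadicCube (d := d) m k).indicator (1 : (Fin d → ℝ) → ℝ) := by
      ext x
      simp
    rw [this]
    exact Submodule.sum_mem _ fun k _ =>
      Submodule.smul_mem _ _ (Submodule.subset_span ⟨k, rfl⟩)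
  have := FiniteDimensional.span_of_finite ℝ (Set.finite_range
    fun k => (ActiveLearning.dyadicCube (d := d) m k).indicator (1 : (Fin d → ℝ) → ℝ))
  exact Submodule.finiteDimensional_of_le hle

theorem one_le_pieceConstDim (d m : ℕ) : 1 ≤ ActiveLearning.pieceConstDim d m := by
  have := finiteDimensional_span_pieceConst d m
  refine Submodule.one_le_finrank_iff.2 fun hbot => ?_
  rw [Submodule.span_eq_bot] at hbot
  have h := congrFun (hbot _ ⟨1, by simp, rfl⟩) 0
  classical
  rw [sum_mul_indicator_dyadicCube, if_pos ⟨le_rfl, zero_le_one⟩] at h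
  simp at h

theorem mem_resolutionLevels_of_le {d N m₀ m : ℕ} (h1 : 1 ≤ m₀) (h : m₀ ≤ m)
    (hm : m ∈ ActiveLearning.resolutionLevels d N) :
    m₀ ∈ ActiveLearning.resolutionLevels d N := by
  refine ⟨h1, one_le_pieceConstDim d m₀, le_trans ?_ hm.2.2⟩
  have := finiteDimensional_span_pieceConst d m
  exact_mod_cast Submodule.finrank_mono (Submodule.span_mono (pieceConst_subset h))

/-! ### Comparison of empirical risks -/

/-- Subtracting from `b + ξ` a function constant on the blocks lowers the sum of squares by at most
`2 ∑ b_j²` plus twice the block energy of `ξ`: complete the square in each block. -/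
theorem le_sum_sq_sub_sq {N : ℕ} {K : Type*} [Fintype K] [DecidableEq K] (κ : Fin N → K)
    (h : K → ℝ) (b ξ : Fin N → ℝ) :
    -2 * ∑ j, b j ^ 2 - 2 * blockEnergy κ ξ ≤
      ∑ j, ((b j + ξ j - h (κ j)) ^ 2 - (b j + ξ j) ^ 2) := by
  have hpt : ∀ j, -2 * b j ^ 2 + (h (κ j) ^ 2 / 2 - 2 * h (κ j) * ξ j) ≤
      (b j + ξ j - h (κ j)) ^ 2 - (b j + ξ j) ^ 2 := fun j => by
    nlinarith [sq_nonneg (h (κ j) - 2 * b j)]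
  refine le_trans ?_ (Finset.sum_le_sum fun j _ => hpt j)
  rw [Finset.sum_add_distrib, ← Finset.mul_sum, sub_eq_add_neg]
  gcongr
  rw [← Finset.sum_fiberwise (s := Finset.univ) (g := κ), blockEnergy, Finset.mul_sum,
    ← Finset.sum_neg_distrib]
  refine Finset.sum_le_sum fun k _ => ?_
  have hs : ∑ j with κ j = k, (h (κ j) ^ 2 / 2 - 2 * h (κ j) * ξ j) =
      (Finset.card {j | κ j = k} : ℝ) * (h k ^ 2 / 2) - 2 * h k * ∑ j with κ j = k, ξ j := by
    rw [← nsmul_eq_mul, ← Finset.sum_const, Finset.mul_sum, ← Finset.sum_sub_distrib]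
    exact Finset.sum_congr rfl fun j hj => by rw [(Finset.mem_filter.1 hj).2]
  rw [hs]
  rcases Finset.eq_empty_or_nonempty (Finset.filter (fun j => κ j = k) Finset.univ) with he | he
  · simp [he]
  · have hn : (0 : ℝ) < (Finset.card {j | κ j = k} : ℝ) := by exact_mod_cast he.card_pos
    set n : ℝ := (Finset.card {j | κ j = k} : ℝ)
    set S := ∑ j with κ j = k, ξ j
    have : n * (h k ^ 2 / 2) - 2 * h k * S - -(2 * (S ^ 2 / n)) =
        n / 2 * (h k - 2 * S / n) ^ 2 := by
      field_simp
      ring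
    have h3 : 0 ≤ n / 2 * (h k - 2 * S / n) ^ 2 := by positivity
    linarith

/-- No function of a finer class improves the empirical risk of `g` by more than the bias of `g`
and the noise energy on the finer partition. -/
theorem le_empRisk_of_le {d N m₀ m : ℕ} (hN : 0 < N) (h : m₀ ≤ m) {x : Fin N → Fin d → ℝ}
    (hx : ∀ j, x j ∈ ActiveLearning.unitCube d) (y : Fin N → ℝ) (η : (Fin d → ℝ) → ℝ)
    {f g : (Fin d → ℝ) → ℝ} (hf : f ∈ ActiveLearning.pieceConst d m)
    (hg : g ∈ ActiveLearning.pieceConst d m₀) :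
    ActiveLearning.empRisk x y g -
        2 * (∑ j, (η (x j) - g (x j)) ^ 2 +
          blockEnergy (fun j => cellIndex m (x j)) (fun j => y j - η (x j))) / N ≤
      ActiveLearning.empRisk x y f := by
  obtain ⟨c, -, rfl⟩ := hf
  obtain ⟨c₀, -, rfl⟩ := hg
  classical
  simp only [ActiveLearning.empRisk, sum_mul_indicator_dyadicCube, if_pos (hx _)]
  have hN' : (0 : ℝ) < N := by exact_mod_cast hN
  rw [← sub_div]
  apply div_le_div_of_nonneg_right _ hN'.le
  have key := le_sum_sq_sub_sq (fun j => cellIndex m (x j)) (fun k => c k - c₀ (coarsen h k))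
    (fun j => η (x j) - c₀ (cellIndex m₀ (x j))) (fun j => y j - η (x j))
  have he : ∑ j, ((η (x j) - c₀ (cellIndex m₀ (x j)) + (y j - η (x j)) -
      (c (cellIndex m (x j)) - c₀ (coarsen h (cellIndex m (x j))))) ^ 2 -
      (η (x j) - c₀ (cellIndex m₀ (x j)) + (y j - η (x j))) ^ 2) =
      ∑ j, (y j - c (cellIndex m (x j))) ^ 2 - ∑ j, (y j - c₀ (cellIndex m₀ (x j))) ^ 2 := by
    rw [← Finset.sum_sub_distrib]
    refine Finset.sum_congr rfl fun j _ => ?_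
    rw [coarsen_cellIndex]
    ring
  rw [he] at key
  linarith

theorem iInf_empRisk_sub_le {d N m₀ m : ℕ} (hN : 0 < N) (h : m₀ ≤ m) {x : Fin N → Fin d → ℝ}
    (hx : ∀ j, x j ∈ ActiveLearning.unitCube d) (y : Fin N → ℝ) (η : (Fin d → ℝ) → ℝ)
    {g : (Fin d → ℝ) → ℝ} (hg : g ∈ ActiveLearning.pieceConst d m₀) :
    (⨅ f : ActiveLearning.pieceConst d m₀, ActiveLearning.empRisk x y f) -
        2 * (∑ j, (η (x j) - g (x j)) ^ 2 +
          blockEnergy (fun j => cellIndex m (x j)) (fun j => y j - η (x j))) / N ≤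
      ⨅ f : ActiveLearning.pieceConst d m, ActiveLearning.empRisk x y f := by
  have : Nonempty (ActiveLearning.pieceConst d m) := ⟨⟨0, zero_mem_pieceConst d m⟩⟩
  refine le_ciInf fun f => le_trans ?_ (le_empRisk_of_le hN h hx y η f.2 hg)
  gcongr
  refine ciInf_le (f := fun f : ActiveLearning.pieceConst d m₀ => ActiveLearning.empRisk x y f)
    ⟨0, ?_⟩ ⟨g, hg⟩
  rintro _ ⟨f, rfl⟩
  exact div_nonneg (Finset.sum_nonneg fun j _ => sq_nonneg _) (Nat.cast_nonneg N)

/-! ### Regression function: truncation and approximation -/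

theorem abs_sub_le_of_mem_holderClass {d : ℕ} {β L : ℝ} (hβ1 : β ≤ 1) {η : (Fin d → ℝ) → ℝ}
    (hη : η ∈ ActiveLearning.HolderClass d β L) {x y : Fin d → ℝ}
    (hx : x ∈ ActiveLearning.unitCube d) (hy : y ∈ ActiveLearning.unitCube d) :
    |η y - η x| ≤ L * ‖x - y‖ ^ β := by
  have h0 : ActiveLearning.holderOrder β = 0 := by
    have : ⌈β⌉₊ ≤ 1 := Nat.ceil_le.2 (by simpa using hβ1)
    unfold ActiveLearning.holderOrder
    omega
  have h := hη.2 x hx y hy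
  rw [h0] at h
  simpa [ActiveLearning.taylorPoly] using h

/-- Truncation of `a` to `[-1, 1]`. -/
noncomputable def clip (a : ℝ) : ℝ := max (-1) (min 1 a)

theorem abs_clip_le (a : ℝ) : |clip a| ≤ 1 :=
  abs_le.2 ⟨le_max_left _ _, max_le (by norm_num) (min_le_left _ _)⟩

theorem clip_eq_self {a : ℝ} (h : |a| ≤ 1) : clip a = a := by
  rw [clip, min_eq_right (abs_le.1 h).2, max_eq_right (abs_le.1 h).1]

theorem abs_clip_sub_clip_le (a b : ℝ) : |clip a - clip b| ≤ |a - b| := by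
  unfold clip
  have h1 := abs_max_sub_max_le_max (-1) (min 1 a) (-1) (min 1 b)
  have h2 := abs_min_sub_min_le_max 1 a 1 b
  simp only [sub_self, abs_zero, abs_nonneg, sup_of_le_right] at h1 h2
  exact h1.trans h2

/-- A regression function of a `±1` label has a version with values in `[-1, 1]`. -/
theorem isRegressionFunction_clip {d : ℕ} {P : Measure ((Fin d → ℝ) × ℝ)}
    (hP : ActiveLearning.IsBinaryLaw P) {η : (Fin d → ℝ) → ℝ}
    (hη : ActiveLearning.IsRegressionFunction P η) :
    ActiveLearning.IsRegressionFunction P fun x => clip (η x) := by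
  refine ⟨measurable_const.max (measurable_const.min hη.1), ?_⟩
  have hb : ∀ᵐ z ∂P, |z.2| ≤ 1 := by
    filter_upwards [hP.support] with z hz
    rcases hz.2 with h | h <;> rw [h] <;> norm_num
  have hc := ae_bdd_abs_condExp_of_ae_bdd_abs (m := MeasurableSpace.comap
    (Prod.fst : (Fin d → ℝ) × ℝ → Fin d → ℝ) inferInstance) hb
  filter_upwards [hη.2, hc] with z h1 h2
  rw [← h1] at h2 ⊢
  exact clip_eq_self h2

theorem norm_sub_corner_le {d m : ℕ} {x : Fin d → ℝ} {k : Fin d → Fin (2 ^ m)}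
    (hx : x ∈ ActiveLearning.dyadicCube m k) :
    ‖x - fun i => ((k i : ℕ) : ℝ) / 2 ^ m‖ ≤ 1 / 2 ^ m := by
  refine (pi_norm_le_iff_of_nonneg (by positivity)).2 fun i => ?_
  obtain ⟨h1, h2⟩ := hx.2 i
  rw [Pi.sub_apply, Real.norm_of_nonneg (by linarith), sub_le_iff_le_add, ← add_div, add_comm]
  rcases h2 with h2 | h2
  · exact h2.le
  · have hk : ((k i : ℕ) : ℝ) + 1 = 2 ^ m := by exact_mod_cast h2
    rw [hk, div_self (by positivity)]
    exact hx.1.2 i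

theorem corner_mem_unitCube {d m : ℕ} (k : Fin d → Fin (2 ^ m)) :
    (fun i => ((k i : ℕ) : ℝ) / 2 ^ m) ∈ ActiveLearning.unitCube d := by
  refine ⟨fun i => by simp only [Pi.zero_apply]; positivity, fun i => ?_⟩
  simp only [Pi.one_apply]
  rw [div_le_one (by positivity)]
  exact_mod_cast (k i).2.le

/-- The piecewise constant function taking on each cube the value of the truncated `η` at the lower
corner approximates the truncated `η` within `L 2^{-mβ}`. -/
theorem exists_pieceConst_approx {d : ℕ} {β L : ℝ} (hβ : 0 < β) (hβ1 : β ≤ 1) (hL : 0 < L)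
    {η : (Fin d → ℝ) → ℝ} (hη : η ∈ ActiveLearning.HolderClass d β L) (m : ℕ) :
    ∃ g ∈ ActiveLearning.pieceConst d m, ∀ x ∈ ActiveLearning.unitCube d,
      |clip (η x) - g x| ≤ L * (1 / 2 ^ m) ^ β := by
  refine ⟨_, ⟨fun k => clip (η fun i => ((k i : ℕ) : ℝ) / 2 ^ m), fun k => abs_clip_le _, rfl⟩,
    fun x hx => ?_⟩
  classical
  simp only
  rw [sum_mul_indicator_dyadicCube (fun k => clip (η fun i => ((k i : ℕ) : ℝ) / 2 ^ m)),
    if_pos hx]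
  refine (abs_clip_sub_clip_le _ _).trans
    ((abs_sub_le_of_mem_holderClass hβ1 hη (corner_mem_unitCube _) hx).trans ?_)
  rw [norm_sub_rev]
  have := norm_sub_corner_le ((mem_dyadicCube_iff (m := m) hx _).2 rfl)
  gcongr

/-! ### Simultaneous control of all levels -/

/-- Uniform control of the noise: outside an event of probability at most `e^{-s}`, the design
points lie in the cube and the noise energies of all dyadic partitions are at most of the order of
the number of cells plus `s`. -/
theorem one_sub_exp_le_of_blockEnergy {d N : ℕ} (hd : 1 ≤ d) {Ω : Type*} [MeasurableSpace Ω]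
    {μ : Measure Ω} [IsProbabilityMeasure μ] {P : Measure ((Fin d → ℝ) × ℝ)}
    (hP : ActiveLearning.IsBinaryLaw P) {η : (Fin d → ℝ) → ℝ}
    (hη : ActiveLearning.IsRegressionFunction P η) (hη1 : ∀ x, |η x| ≤ 1)
    {X : Fin N → Ω → Fin d → ℝ} {Y : Fin N → Ω → ℝ}
    (hXY : ActiveLearning.IsIIDSample μ P X Y) {s : ℝ} {S : Set Ω}
    (hS : ∀ ω, (∀ j, X j ω ∈ ActiveLearning.unitCube d) →
      (∀ m, blockEnergy (fun j => cellIndex m (X j ω)) (fun j => Y j ω - η (X j ω)) ≤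
        4 * (2 * 2 ^ (d * m) + s)) → ω ∈ S) :
    1 - Real.exp (-s) ≤ μ.real S := by
  -- The deviations `s + (m + 1) log 2` make the exceptional probabilities sum to `e^{-s}`.
  set B : ℕ → Set Ω := fun m =>
    {ω | 4 * (Fintype.card (Fin d → Fin (2 ^ m)) * Real.log 2 + (s + (m + 1 : ℕ) * Real.log 2)) ≤
      blockEnergy (fun j => cellIndex m (X j ω)) (fun j => Y j ω - η (X j ω))}
  set Z : Set Ω := {ω | ¬ ∀ j, X j ω ∈ ActiveLearning.unitCube d}
  have hZ : μ Z = 0 := by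
    have : ∀ᵐ ω ∂μ, ∀ j, X j ω ∈ ActiveLearning.unitCube d := by
      refine ae_all_iff.2 fun j => ?_
      have h := hP.support
      rw [← hXY.law j] at h
      exact (ae_of_ae_map ((hXY.measurable_X j).prodMk (hXY.measurable_Y j)).aemeasurable h).mono
        fun ω hω => hω.1
    exact this
  have hB : μ (⋃ m, B m) ≤ ENNReal.ofReal (Real.exp (-s)) := by
    refine (measure_iUnion_le B).trans ?_
    have hm : ∀ m, μ (B m) ≤ ENNReal.ofReal (Real.exp (-s)) * 2⁻¹ ^ (m + 1) := by
      intro m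
      refine (measure_blockEnergy_ge_le hP hη hη1 hXY (measurableSet_cellIndex_preimage m) _).trans_eq ?_
      rw [neg_add, Real.exp_add, ENNReal.ofReal_mul (Real.exp_pos _).le, ← mul_neg,
        ← Real.log_inv, ← Real.log_pow, Real.exp_log (by positivity),
        ENNReal.ofReal_pow (by positivity), ENNReal.ofReal_inv_of_pos two_pos]
      simp
    refine (ENNReal.tsum_le_tsum hm).trans_eq ?_
    rw [ENNReal.tsum_mul_left, ENNReal.tsum_geometric_add_one, ENNReal.one_sub_inv_two, inv_inv,
      ENNReal.inv_mul_cancel two_ne_zero ENNReal.ofNat_ne_top, mul_one]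
  have hcov : Set.univ ⊆ S ∪ (Z ∪ ⋃ m, B m) := by
    intro ω _
    by_contra hω
    simp only [Set.mem_union, Set.mem_iUnion, not_or, not_exists] at hω
    obtain ⟨h1, h2, h3⟩ := hω
    refine h1 (hS ω (not_not.1 h2) fun m => (not_le.1 (h3 m)).le.trans ?_)
    have hcard : (Fintype.card (Fin d → Fin (2 ^ m)) : ℝ) = 2 ^ (d * m) := by
      simp [← pow_mul, mul_comm]
    have hlog : Real.log 2 ≤ 1 := by linarith [Real.log_two_lt_d9]
    have hlog0 : 0 ≤ Real.log 2 := Real.log_nonneg (by norm_num)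
    have hmD : ((m + 1 : ℕ) : ℝ) ≤ 2 ^ (d * m) := by
      exact_mod_cast (Nat.lt_two_pow_self (n := m)).trans_le
        (Nat.pow_le_pow_right (by norm_num) (Nat.le_mul_of_pos_left m hd))
    rw [hcard]
    have e1 : (2 : ℝ) ^ (d * m) * Real.log 2 ≤ 2 ^ (d * m) * 1 := by gcongr
    have e2 : ((m + 1 : ℕ) : ℝ) * Real.log 2 ≤ 2 ^ (d * m) * 1 := by gcongr
    linarith
  have h1 : 1 ≤ μ.real S + μ.real (Z ∪ ⋃ m, B m) := by
    have := (measureReal_mono (μ := μ) hcov).trans (measureReal_union_le _ _)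
    simpa using this
  have h2 : μ.real (Z ∪ ⋃ m, B m) ≤ Real.exp (-s) := by
    refine (measureReal_union_le _ _).trans ?_
    rw [measureReal_def, hZ, ENNReal.toReal_zero, zero_add]
    exact ENNReal.toReal_le_of_le_ofReal (Real.exp_pos _).le hB
  linarith

/-! ### Overfitting levels are not selected -/

/-- The level at which the variance `2^{dm} / N` catches up with the squared bias `2^{-2mβ}`. -/
theorem mul_sq_rpow_le {d m N : ℕ} {β : ℝ}
    (h : (N : ℝ) ≤ ((2 : ℝ) ^ m) ^ (2 * β + d)) :
    (N : ℝ) * ((1 / 2 ^ m : ℝ) ^ β) ^ 2 ≤ 2 ^ (d * m) := by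
  have h2 : (0 : ℝ) < 2 ^ m := by positivity
  have he : ((2 : ℝ) ^ m) ^ (2 * β + d) = (((2 : ℝ) ^ m) ^ β) ^ 2 * 2 ^ (d * m) := by
    rw [Real.rpow_add h2, Real.rpow_natCast, ← pow_mul, mul_comm m d, mul_comm 2 β,
      Real.rpow_mul h2.le, Real.rpow_two]
  rw [Real.div_rpow zero_le_one h2.le, Real.one_rpow, div_pow, one_pow, mul_one_div,
    div_le_iff₀ (by positivity), mul_comm (2 ^ (d * m)), ← he]
  exact h

theorem sum_sq_le_of_abs_le {d m N : ℕ} {β L : ℝ} (h : (N : ℝ) ≤ ((2 : ℝ) ^ m) ^ (2 * β + d))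
    {b : Fin N → ℝ} (hb : ∀ j, |b j| ≤ L * (1 / 2 ^ m : ℝ) ^ β) :
    ∑ j, b j ^ 2 ≤ L ^ 2 * 2 ^ (d * m) := by
  calc ∑ j, b j ^ 2 ≤ ∑ _j : Fin N, (L * (1 / 2 ^ m : ℝ) ^ β) ^ 2 := by
        refine Finset.sum_le_sum fun j _ => ?_
        rw [← sq_abs]
        exact pow_le_pow_left₀ (abs_nonneg _) (hb j) 2
    _ = L ^ 2 * (N * ((1 / 2 ^ m : ℝ) ^ β) ^ 2) := by
        rw [Finset.sum_const, Finset.card_univ, Fintype.card_fin, nsmul_eq_mul]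
        ring
    _ ≤ L ^ 2 * 2 ^ (d * m) := by
        gcongr
        exact mul_sq_rpow_le h

/-- A level `m ≥ 1` whose cube side is `N^{-1/q}` up to a factor `2`. -/
theorem exists_two_pow_near_rpow {N : ℕ} (hN : 2 ≤ N) {q : ℝ} (hq : 0 < q) :
    ∃ m : ℕ, 1 ≤ m ∧ (N : ℝ) ≤ ((2 : ℝ) ^ m) ^ q ∧ (2 : ℝ) ^ m ≤ 2 * (N : ℝ) ^ (1 / q) := by
  have hN0 : (0 : ℝ) < N := by positivity
  have hlog : 1 ≤ Real.logb 2 N := by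
    rw [Real.le_logb_iff_rpow_le (by norm_num) hN0]
    simpa using (by exact_mod_cast hN : (2 : ℝ) ≤ N)
  have hpos : 0 < Real.logb 2 N / q := by positivity
  have hpow : (2 : ℝ) ^ (Real.logb 2 N / q) = (N : ℝ) ^ (1 / q) := by
    rw [div_eq_mul_one_div, Real.rpow_mul (by norm_num), Real.rpow_logb (by norm_num)
      (by norm_num) hN0]
  refine ⟨⌈Real.logb 2 N / q⌉₊, Nat.one_le_ceil_iff.2 hpos, ?_, ?_⟩
  · have h1 : (N : ℝ) ^ (1 / q) ≤ 2 ^ ⌈Real.logb 2 N / q⌉₊ := by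
      rw [← hpow, ← Real.rpow_natCast]
      exact Real.rpow_le_rpow_of_exponent_le (by norm_num) (Nat.le_ceil _)
    have h2 := Real.rpow_le_rpow (by positivity) h1 hq.le
    rwa [← Real.rpow_mul hN0.le, one_div_mul_cancel hq.ne', Real.rpow_one] at h2
  · rw [← hpow, ← Real.rpow_natCast, mul_comm, ← Real.rpow_add_one (by norm_num)]
    exact Real.rpow_le_rpow_of_exponent_le (by norm_num) (Nat.ceil_lt_add_one hpos.le).le

/-- A selected level cannot exceed by `c` or more a level `m₀` at which the squared bias `L² D₀`
is comparable with the number `D₀` of cells. -/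
theorem lt_of_isSelectedResolution {d N : ℕ} (hd : 1 ≤ d) (hN : 2 ≤ N) {K₁ s L : ℝ}
    (hK : 40 ≤ K₁) (hs : 0 < s) {x : Fin N → Fin d → ℝ} {y : Fin N → ℝ} {η : (Fin d → ℝ) → ℝ}
    (hx : ∀ j, x j ∈ ActiveLearning.unitCube d) {m m₀ c : ℕ}
    (hm : ActiveLearning.IsSelectedResolution K₁ s x y m) (hm₀ : 1 ≤ m₀) (hc : 1 ≤ c)
    (hcL : 2 * L ^ 2 ≤ 2 ^ c) {g : (Fin d → ℝ) → ℝ} (hg : g ∈ ActiveLearning.pieceConst d m₀)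
    (hbias : ∑ j, (η (x j) - g (x j)) ^ 2 ≤ L ^ 2 * 2 ^ (d * m₀))
    (hnoise : blockEnergy (fun j => cellIndex m (x j)) (fun j => y j - η (x j)) ≤
      4 * (2 * 2 ^ (d * m) + s)) : m < m₀ + c := by
  by_contra hlt
  have hle : m₀ + c ≤ m := not_lt.1 hlt
  have hm₀m : m₀ ≤ m := by omega
  have hN0 : (0 : ℝ) < N := by positivity
  have hmin : ActiveLearning.criterion K₁ s x y m ≤ ActiveLearning.criterion K₁ s x y m₀ :=
    hm.2 (mem_resolutionLevels_of_le hm₀ hm₀m hm.1)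
  have hinf := iInf_empRisk_sub_le (by omega : 0 < N) hm₀m hx y η hg
  have hT : 0 ≤ Real.log (Real.logb 2 N) := by
    apply Real.log_nonneg
    rw [Real.le_logb_iff_rpow_le (by norm_num) hN0]
    simpa using (by exact_mod_cast hN : (2 : ℝ) ≤ N)
  set T := s + Real.log (Real.logb 2 N) with hTdef
  set D : ℝ := 2 ^ (d * m)
  set D₀ : ℝ := 2 ^ (d * m₀)
  have hD₀ : 0 < D₀ := by positivity
  have hD : 2 ^ c * D₀ ≤ D := by
    rw [← pow_add]
    apply pow_le_pow_right₀ (by norm_num)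
    nlinarith
  have hD2 : 2 * D₀ ≤ D := by
    refine le_trans ?_ hD
    gcongr
    exact le_self_pow₀ (by norm_num) (by omega)
  have hDL : 2 * L ^ 2 * D₀ ≤ D := le_trans (by gcongr) hD
  -- The penalty gained between the levels is paid for by bias and noise energy.
  have hpen : K₁ * ((D - D₀) + (m - m₀) * T) ≤ 2 * (L ^ 2 * D₀ + 4 * (2 * D + s)) := by
    simp only [ActiveLearning.criterion] at hmin
    have h1 : K₁ * (D + m * T) / N - K₁ * (D₀ + m₀ * T) / N ≤
        2 * (L ^ 2 * D₀ + 4 * (2 * D + s)) / N := by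
      refine le_trans ?_ (by gcongr : 2 * (∑ j, (η (x j) - g (x j)) ^ 2 +
        blockEnergy (fun j => cellIndex m (x j)) (fun j => y j - η (x j))) / (N : ℝ) ≤ _)
      linarith
    rw [← sub_div] at h1
    have := (div_le_div_iff_of_pos_right hN0).1 h1
    linarith
  have hmm : (1 : ℝ) ≤ m - m₀ := by
    have : (m₀ : ℝ) + 1 ≤ m := by exact_mod_cast (by omega : m₀ + 1 ≤ m)
    linarith
  have hlow : D / 2 + s ≤ (D - D₀) + (m - m₀) * T := by
    have : 1 * s ≤ ((m : ℝ) - m₀) * T := by gcongr; linarith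
    linarith
  have : 40 * (D / 2 + s) ≤ K₁ * ((D - D₀) + (m - m₀) * T) := by
    gcongr
  linarith

theorem corollary1 :
    ∃ K₀ : ℝ, 0 < K₀ ∧
      ∀ (d : ℕ) (β L : ℝ), 1 ≤ d → 0 < β → β ≤ 1 → 0 < L →
        ∃ C₁ : ℝ, 0 < C₁ ∧
          ∀ (K₁ : ℝ), K₀ ≤ K₁ →
          ∀ (P : Measure ((Fin d → ℝ) × ℝ)), ActiveLearning.IsBinaryLaw P →
          ∀ (η : (Fin d → ℝ) → ℝ), ActiveLearning.IsRegressionFunction P η →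
            η ∈ ActiveLearning.HolderClass d β L →
          ∀ (N : ℕ), 2 ≤ N → ∀ (s : ℝ), 0 < s →
          ∀ (Ω : Type*) [MeasurableSpace Ω] (μ : Measure Ω) [IsProbabilityMeasure μ]
            (X : Fin N → Ω → Fin d → ℝ) (Y : Fin N → Ω → ℝ),
            ActiveLearning.IsIIDSample μ P X Y →
          ∀ (mhat : Ω → ℕ),
            (∀ ω, ActiveLearning.IsSelectedResolution K₁ s
              (fun j => X j ω) (fun j => Y j ω) (mhat ω)) →
            1 - Real.exp (-s) ≤
              μ.real {ω | (2 : ℝ) ^ mhat ω ≤ C₁ * (N : ℝ) ^ (1 / (2 * β + d))} := by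
  refine ⟨40, by norm_num, fun d β L hd hβ hβ1 hL => ?_⟩
  obtain ⟨c₀, hc₀⟩ := pow_unbounded_of_one_lt (2 * L ^ 2) (one_lt_two (α := ℝ))
  have hcL : 2 * L ^ 2 ≤ 2 ^ (c₀ + 1) :=
    hc₀.le.trans (pow_le_pow_right₀ (by norm_num) (by omega))
  -- `2^{c₀+1}` is the gap to the balancing level `m₀`, and `2` the rounding of `m₀` to an integer.
  refine ⟨2 ^ (c₀ + 1) * 2, by positivity, ?_⟩
  intro K₁ hK P hP η hη hηH N hN s hs Ω _ μ _ X Y hXY mhat hmhat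
  obtain ⟨m₀, hm₀, hNle, hm₀le⟩ := exists_two_pow_near_rpow hN (by positivity : 0 < 2 * β + d)
  obtain ⟨g, hg, hgη⟩ := exists_pieceConst_approx hβ hβ1 hL hηH m₀
  refine one_sub_exp_le_of_blockEnergy hd hP (isRegressionFunction_clip hP hη)
    (fun x => abs_clip_le _) hXY fun ω hX hQ => ?_
  have hbias : ∑ j, (clip (η (X j ω)) - g (X j ω)) ^ 2 ≤ L ^ 2 * 2 ^ (d * m₀) :=
    sum_sq_le_of_abs_le hNle fun j => hgη _ (hX j)
  have hlt := lt_of_isSelectedResolution (x := fun j => X j ω) (y := fun j => Y j ω)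
    (η := fun x => clip (η x)) hd hN hK hs hX (hmhat ω) hm₀ (by omega) hcL hg
    hbias (hQ _)
  rw [Set.mem_ofPred_eq]
  calc (2 : ℝ) ^ mhat ω ≤ 2 ^ (m₀ + (c₀ + 1)) := pow_le_pow_right₀ (by norm_num) hlt.le
    _ = 2 ^ (c₀ + 1) * 2 ^ m₀ := by rw [pow_add, mul_comm]
    _ ≤ 2 ^ (c₀ + 1) * (2 * (N : ℝ) ^ (1 / (2 * β + d))) := by gcongr
    _ = _ := by ring
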